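/- Let $\mathbb K\in\{\mathbb R,\mathbb C\}$ and let $(\Omega,\Sigma,\mu)$ be a non-atomic probability space, i.e. every $A\in\Sigma$ with $\mu(A)>0$ contains some $B\in\Sigma$ with $0<\mu(B)<\mu(A)$. Write $L^1(\Omega)$ for the Banach space of ($\mu$-a.e. classes of) $\mathbb K$-valued integrable functions. For $A\in\Sigma$ let $L^1(A)$ be the subspace of all $f\in L^1(\Omega)$ that vanish almost everywhere outside $A$, and let $P_A\colon L^1(\Omega)\to L^1(A)$ be the projection $P_A(f)=\chi_A f$. A subspace $X$ of $L^1(\Omega)$ is called small if there is no $A\in\Sigma$ with $\mu(A)>0$ such that $P_A$ maps $X$ onto $L^1(A)$. A Banach space $E$ over $\mathbb K$ has the Daugavet property if $\|\mathrm{Id}+T\|=1+\|T\|$ for every bounded linear operator $T\colon E\to E$ of rank one. A closed subspace $Y$ of a Banach space $E$ with the Daugavet property is called poor if the quotient $E/Z$ has the Daugavet property for every closed subspace $Z\subset Y$. Then every small closed subspace $X$ of $L^1(\Omega)$ is a poor subspace of $L^1(\Omega)$. (In particular, $L^1(\Omega)$ itself has the Daugavet property.) -/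

import Mathlib

open MeasureTheory
open scoped ENNReal

/-- A finite measure is non-atomic if every measurable set of positive measure contains a
measurable subset of strictly smaller positive measure. (This is stronger than merely requiring
singletons to be null.) -/
def IsNonAtomicMeasure {Ω : Type*} [MeasurableSpace Ω] (μ : Measure Ω) : Prop :=
  ∀ A : Set Ω, MeasurableSet A → 0 < μ A →
    ∃ B : Set Ω, B ⊆ A ∧ MeasurableSet B ∧ 0 < μ B ∧ μ B < μ A

/-- A Banach space `E` over `𝕜` has the Daugavet property if `‖Id + T‖ = 1 + ‖T‖` for every
bounded operator `T : E → E` of rank one. -/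
def HasDaugavetProperty (𝕜 : Type*) [RCLike 𝕜] (E : Type*) [NormedAddCommGroup E]
    [NormedSpace 𝕜 E] : Prop :=
  ∀ T : E →L[𝕜] E, Module.finrank 𝕜 (LinearMap.range (T : E →ₗ[𝕜] E)) = 1 →
    ‖ContinuousLinearMap.id 𝕜 E + T‖ = 1 + ‖T‖

/-- A closed subspace `Y` of a Banach space `E` with the Daugavet property is poor if `E ⧸ Z`
(with the quotient norm) has the Daugavet property for every closed subspace `Z ⊆ Y`. -/
def IsPoorSubspace {𝕜 : Type*} [RCLike 𝕜] {E : Type*} [NormedAddCommGroup E]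
    [NormedSpace 𝕜 E] (Y : Submodule 𝕜 E) : Prop :=
  HasDaugavetProperty 𝕜 E ∧ IsClosed (Y : Set E) ∧
    ∀ (Z : Submodule 𝕜 E) [IsClosed (Z : Set E)], Z ≤ Y → HasDaugavetProperty 𝕜 (E ⧸ Z)

section L1

variable (𝕜 : Type*) [RCLike 𝕜] {Ω : Type*} [MeasurableSpace Ω] (μ : Measure Ω)

/-- `L¹(A)`: the subspace of those `f ∈ L¹(μ)` that vanish almost everywhere outside `A`. -/
def L1On (A : Set Ω) : Submodule 𝕜 (Lp 𝕜 1 μ) where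
  carrier := {f | ∀ᵐ x ∂μ, x ∉ A → f x = 0}
  zero_mem' := by
    filter_upwards [Lp.coeFn_zero 𝕜 1 μ] with x hx _
    exact hx
  add_mem' := by
    intro f g hf hg
    filter_upwards [hf, hg, Lp.coeFn_add f g] with x h1 h2 h3 hx
    rw [h3, Pi.add_apply, h1 hx, h2 hx, add_zero]
  smul_mem' := by
    intro c f hf
    filter_upwards [hf, Lp.coeFn_smul c f] with x h1 h2 hx
    rw [h2, Pi.smul_apply, h1 hx, smul_zero]

/-- The projection `P_A f = χ_A f` on `L¹(μ)`, for a measurable set `A`. -/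
noncomputable def projL1 {A : Set Ω} (hA : MeasurableSet A) : Lp 𝕜 1 μ →ₗ[𝕜] Lp 𝕜 1 μ where
  toFun f := ((Lp.memLp f).indicator hA).toLp _
  map_add' f g := by
    rw [← MemLp.toLp_add, MemLp.toLp_eq_toLp_iff, ← Set.indicator_add']
    filter_upwards [Lp.coeFn_add f g] with x hx
    simp only [Set.indicator, hx]
  map_smul' c f := by
    rw [RingHom.id_apply, ← MemLp.toLp_const_smul, MemLp.toLp_eq_toLp_iff]
    filter_upwards [Lp.coeFn_smul c f] with x hx
    by_cases hxA : x ∈ A <;> simp [Set.indicator, hx, hxA]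

variable {𝕜 μ}

theorem coeFn_projL1 {A : Set Ω} (hA : MeasurableSet A) (f : Lp 𝕜 1 μ) :
    ∀ᵐ x ∂μ, (projL1 𝕜 μ hA f) x = A.indicator f x := by
  have hm := (Lp.memLp f).indicator hA
  have h : projL1 𝕜 μ hA f = hm.toLp _ := rfl
  rw [h]
  filter_upwards [hm.coeFn_toLp] with x hx
  rw [hx]

/-- A subspace `X` of `L¹(μ)` is small if there is no measurable set `A` of positive measure such
that `P_A` maps `X` onto `L¹(A)`. -/
def IsSmallSubspace (X : Submodule 𝕜 (Lp 𝕜 1 μ)) : Prop :=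
  ¬ ∃ (A : Set Ω) (hA : MeasurableSet A), 0 < μ A ∧ X.map (projL1 𝕜 μ hA) = L1On 𝕜 μ A

end L1

/-! The dual of `L¹/Z` is the annihilator of `Z` in `L^∞`, and subspaces of small subspaces are
small, so it is enough to treat `L¹/Z` for `Z` closed and small (`Z = ⊥` gives `L¹` itself). Let `ℓ`
be a norm-one functional on `L¹/Z`, given by `g₀`, and `e` a unit vector with lift `f` and norming
functional `g₁`. By `hasDaugavetProperty_of_forall_exists` one seeks `x` in the unit ball with `ℓ x
≈ 1` and `e`, `x` almost normed by a common functional.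

Choose `c` with `‖c‖ ≈ 1` and a set of positive measure where `g₀ ≈ c`.
`exists_annihilator_near_const` changes `g₁` to another annihilator `g` in the unit ball with `∫ g f
≈ 1` and `g ≈ c` on some `B` in that set. A normalized multiple `h` of `χ_B` then has `∫ g₀ h ≈ ∫ g
h ≈ 1`, and its class is the required `x`.

Smallness enters through `exists_annihilator_bump`: as `P_A` does not map `Z` onto `L¹(A)`, the
adjoint of `P_A|Z` is not bounded below, and Hahn–Banach yields annihilators in the unit ball that
are nearly supported on `A` and close to `1` on part of `A`. Such a bump is uncontrolled on the rest
of `A`. Hence `exists_annihilator_near_segment` adds many bumps with a tiny coefficient on nested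
sets: each point meets at most one uncontrolled step, so values stay near a segment, and convexity
of the unit ball bounds the result. -/

/-! ### Surjectivity and lower bounds for the adjoint. -/

section Duality

variable {𝕜 : Type*} [RCLike 𝕜] {Z F : Type*} [NormedAddCommGroup Z] [NormedSpace 𝕜 Z]
  [NormedAddCommGroup F] [NormedSpace 𝕜 F]

/-- A bounded operator on a Banach space which solves `T z = y` up to half of the norm of `y`, with
linear control of `z`, is onto. -/
theorem ContinuousLinearMap.surjective_of_approx [CompleteSpace Z] (T : Z →L[𝕜] F) (C : ℝ)
    (h : ∀ y, ∃ z, ‖z‖ ≤ C * ‖y‖ ∧ ‖y - T z‖ ≤ 1 / 2 * ‖y‖) : Function.Surjective T := by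
  intro y
  choose g hg hgT using h
  -- `r n` is the residual after `n` corrections; it halves each time, so the corrections sum to a
  -- preimage of `y`.
  set r : ℕ → F := fun n => (fun y => y - T (g y))^[n] y with hr
  have hr_succ : ∀ n, r (n + 1) = r n - T (g (r n)) := fun n => by
    simp only [hr, Function.iterate_succ_apply']
  have hr_norm : ∀ n, ‖r n‖ ≤ (1 / 2) ^ n * ‖y‖ := by
    intro n
    induction n with
    | zero => simp [hr]
    | succ n ih =>
      rw [hr_succ, pow_succ']
      calc _ ≤ 1 / 2 * ‖r n‖ := hgT _
        _ ≤ 1 / 2 * ((1 / 2) ^ n * ‖y‖) := by gcongr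
        _ = _ := by ring
  have hgeom : Summable fun n : ℕ => |C| * ((1 / 2 : ℝ) ^ n * ‖y‖) :=
    (((summable_geometric_of_lt_one (by norm_num) (by norm_num)).mul_right _).mul_left _)
  have hsum : Summable fun n => g (r n) := by
    refine Summable.of_norm_bounded hgeom fun n => ?_
    calc _ ≤ C * ‖r n‖ := hg _
      _ ≤ |C| * ‖r n‖ := by gcongr; exact le_abs_self C
      _ ≤ _ := by gcongr; exact hr_norm n
  have hpartial : ∀ n, T (∑ i ∈ Finset.range n, g (r i)) = y - r n := by
    intro n
    induction n with
    | zero => simp [hr]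
    | succ n ih => rw [Finset.sum_range_succ, map_add, ih, hr_succ]; abel
  have hr_zero : Filter.Tendsto r Filter.atTop (nhds 0) := by
    refine squeeze_zero_norm hr_norm ?_
    simpa using (tendsto_pow_atTop_nhds_zero_of_lt_one (r := (1 / 2 : ℝ)) (by norm_num)
      (by norm_num)).mul_const ‖y‖
  refine ⟨∑' n, g (r n), tendsto_nhds_unique
    ((T.continuous.tendsto _).comp hsum.hasSum.tendsto_sum_nat) ?_⟩
  have : (T ∘ fun n => ∑ i ∈ Finset.range n, g (r i)) = fun n => y - r n := funext hpartial
  rw [this]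
  simpa using hr_zero.const_sub y

/-- A bounded operator on a Banach space whose adjoint is bounded below is onto. -/
theorem ContinuousLinearMap.surjective_of_le_norm_comp [CompleteSpace Z] (T : Z →L[𝕜] F) {δ : ℝ}
    (hδ : 0 < δ) (h : ∀ ℓ : F →L[𝕜] 𝕜, δ * ‖ℓ‖ ≤ ‖ℓ.comp T‖) : Function.Surjective T := by
  refine T.surjective_of_approx (2 / δ) fun y => ?_
  rcases eq_or_ne y 0 with rfl | hy
  · exact ⟨0, by simp⟩
  have hy0 : 0 < ‖y‖ := norm_pos_iff.2 hy
  set R : ℝ := 2 / δ * ‖y‖ with hR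
  have hR0 : 0 < R := by positivity
  let _ : NormedSpace ℝ F := NormedSpace.restrictScalars ℝ 𝕜 F
  let _ : NormedSpace ℝ Z := NormedSpace.restrictScalars ℝ 𝕜 Z
  have : IsScalarTower ℝ 𝕜 F := RestrictScalars.isScalarTower ℝ 𝕜 F
  have : IsScalarTower ℝ 𝕜 Z := RestrictScalars.isScalarTower ℝ 𝕜 Z
  have hmem : y ∈ closure (T '' Metric.closedBall 0 R) := by
    by_contra hmem
    have hconv : Convex ℝ (closure (T '' Metric.closedBall 0 R)) :=
      ((convex_closedBall (0 : Z) R).is_linear_image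
        (T.restrictScalars ℝ : Z →L[ℝ] F).toLinearMap.isLinear).closure
    obtain ⟨ℓ, u, hu, huy⟩ :=
      RCLike.geometric_hahn_banach_closed_point (𝕜 := 𝕜) hconv isClosed_closure hmem
    have hbound : ∀ z ∈ Metric.closedBall (0 : Z) R, ‖ℓ.comp T z‖ ≤ u := by
      intro z hz
      -- The ball is invariant under unimodular scalars, so the bound on the real part is a bound on
      -- the norm.
      obtain ⟨c, hc, hcz⟩ := RCLike.exists_norm_eq_mul_self (ℓ (T z))
      have hcz' : c • z ∈ Metric.closedBall (0 : Z) R := by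
        simpa [norm_smul, hc] using hz
      have := hu _ (subset_closure ⟨_, hcz', rfl⟩)
      rw [map_smul, map_smul, smul_eq_mul, ← hcz, RCLike.ofReal_re] at this
      exact this.le
    have h1 := ContinuousLinearMap.opNorm_bound_of_ball_bound hR0 u (ℓ.comp T) hbound
    have h2 := (h ℓ).trans h1
    have h3 : RCLike.re (ℓ y) ≤ ‖ℓ‖ * ‖y‖ := (RCLike.re_le_norm _).trans (ℓ.le_opNorm y)
    rw [le_div_iff₀ hR0] at h2
    have h4 : δ * ‖ℓ‖ * R = 2 * (‖ℓ‖ * ‖y‖) := by rw [hR]; field_simp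
    have h5 : 0 ≤ ‖ℓ‖ * ‖y‖ := by positivity
    linarith
  obtain ⟨_, ⟨z, hz, rfl⟩, hzy⟩ := Metric.mem_closure_iff.1 hmem (1 / 2 * ‖y‖) (by positivity)
  exact ⟨z, by simpa using hz, by rw [← dist_eq_norm]; exact hzy.le⟩

/-- If a bounded operator on a Banach space is not onto, then its adjoint takes some functional of
norm one to a functional of arbitrarily small norm. -/
theorem ContinuousLinearMap.exists_norm_comp_le_of_not_surjective [CompleteSpace Z]
    (T : Z →L[𝕜] F) (hT : ¬ Function.Surjective T) {δ : ℝ} (hδ : 0 < δ) :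
    ∃ ℓ : F →L[𝕜] 𝕜, ‖ℓ‖ = 1 ∧ ‖ℓ.comp T‖ ≤ δ := by
  by_contra! hcon
  refine hT (T.surjective_of_le_norm_comp hδ fun ℓ => ?_)
  rcases eq_or_ne ℓ 0 with rfl | hℓ
  · simp
  have hℓ0 : 0 < ‖ℓ‖ := norm_pos_iff.2 hℓ
  have h1 := hcon (((‖ℓ‖⁻¹ : ℝ) : 𝕜) • ℓ) (by
    rw [norm_smul, RCLike.norm_ofReal, abs_of_pos (inv_pos.2 hℓ0), inv_mul_cancel₀ hℓ0.ne'])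
  rw [ContinuousLinearMap.smul_comp, norm_smul, RCLike.norm_ofReal, abs_of_pos (inv_pos.2 hℓ0),
    inv_mul_eq_div, lt_div_iff₀ hℓ0] at h1
  exact h1.le

end Duality

/-! ### A criterion for the Daugavet property. -/

section RankOne

variable {𝕜 : Type*} [RCLike 𝕜] {E : Type*} [NormedAddCommGroup E] [NormedSpace 𝕜 E]

/-- A sufficient condition for the Daugavet property. -/
theorem hasDaugavetProperty_of_forall_exists
    (h : ∀ (ℓ : E →L[𝕜] 𝕜) (e : E), ‖ℓ‖ = 1 → ‖e‖ = 1 → ∀ ε : ℝ, 0 < ε →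
      ∃ x : E, ‖x‖ ≤ 1 ∧ ∀ a : ℝ, 0 ≤ a → (1 - ε) + a * (1 - ε) ≤ ‖x + ((a : 𝕜) * ℓ x) • e‖) :
    HasDaugavetProperty 𝕜 E := by
  intro T hT
  refine le_antisymm ((norm_add_le _ _).trans
    (add_le_add_left (ContinuousLinearMap.norm_id_le) _)) ?_
  obtain ⟨⟨v, hv⟩, hv0, hspan⟩ := finrank_eq_one_iff'.1 hT
  have hv0' : v ≠ 0 := fun h0 => hv0 (Subtype.ext h0)
  set e : E := ((‖v‖⁻¹ : ℝ) : 𝕜) • v with he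
  have hnv : 0 < ‖v‖ := norm_pos_iff.2 hv0'
  have he1 : ‖e‖ = 1 := by
    rw [he, norm_smul, RCLike.norm_ofReal, abs_of_pos (inv_pos.2 hnv), inv_mul_cancel₀ hnv.ne']
  obtain ⟨φ, hφ, hφe⟩ := exists_dual_vector 𝕜 e (by rw [he1]; exact one_ne_zero)
  -- The range is spanned by `e` and `φ e = 1`, so `φ` reads off the coefficient.
  have hTe : ∀ x, T x = φ (T x) • e := by
    intro x
    obtain ⟨c, hc⟩ := hspan ⟨T x, x, rfl⟩
    have hc' : T x = (c * ‖v‖) • e := by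
      rw [← show c • v = T x from congrArg Subtype.val hc, he, smul_smul, mul_assoc,
        ← RCLike.ofReal_mul, mul_inv_cancel₀ hnv.ne', RCLike.ofReal_one, mul_one]
    rw [hc', map_smul, hφe, he1]
    simp
  have hT0 : 0 < ‖T‖ := by
    rw [norm_pos_iff]
    rintro rfl
    obtain ⟨w, hw⟩ := hv
    exact hv0' (by simpa using hw.symm)
  set ℓ : E →L[𝕜] 𝕜 := ((‖T‖⁻¹ : ℝ) : 𝕜) • φ.comp T with hℓ
  have hℓT : ∀ x, T x = ((‖T‖ : 𝕜) * ℓ x) • e := by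
    intro x
    rw [hℓ, _root_.smul_apply, smul_eq_mul, ← mul_assoc, ← RCLike.ofReal_mul,
      mul_inv_cancel₀ hT0.ne', RCLike.ofReal_one, one_mul]
    exact hTe x
  have hℓ1 : ‖ℓ‖ = 1 := by
    have h1 : ‖φ.comp T‖ = ‖T‖ := by
      refine le_antisymm ((ContinuousLinearMap.opNorm_comp_le _ _).trans (by rw [hφ, one_mul]))
        (T.opNorm_le_bound (norm_nonneg _) fun x => ?_)
      rw [hTe x, norm_smul, he1, mul_one]
      exact (φ.comp T).le_opNorm x
    rw [hℓ, norm_smul, h1, RCLike.norm_ofReal, abs_of_pos (inv_pos.2 hT0),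
      inv_mul_cancel₀ hT0.ne']
  refine le_of_forall_pos_le_add fun ε hε => ?_
  obtain ⟨x, hx, hx2⟩ := h ℓ e hℓ1 he1 (ε / (1 + ‖T‖)) (by positivity)
  have h1 := hx2 ‖T‖ hT0.le
  rw [← hℓT] at h1
  have h2 : ‖x + T x‖ ≤ ‖ContinuousLinearMap.id 𝕜 E + T‖ :=
    (ContinuousLinearMap.unit_le_opNorm (ContinuousLinearMap.id 𝕜 E + T) x hx)
  have h3 : (1 - ε / (1 + ‖T‖)) + ‖T‖ * (1 - ε / (1 + ‖T‖)) = 1 + ‖T‖ - ε := by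
    field_simp
  linarith

end RankOne

/-! ### The dual of `L¹` as bounded functions. -/

section L1Dual

variable {𝕜 : Type*} [RCLike 𝕜] {Ω : Type*} [MeasurableSpace Ω] {μ : Measure Ω}

theorem integrable_mul_L1 {g : Ω → 𝕜} (hg : Measurable g) {C : ℝ} (hC : ∀ x, ‖g x‖ ≤ C)
    (f : Lp 𝕜 1 μ) : Integrable (fun x => g x * f x) μ :=
  (L1.integrable_coeFn f).bdd_mul hg.aestronglyMeasurable (.of_forall hC)

theorem norm_integral_mul_L1_le {g : Ω → 𝕜} {C : ℝ} (hC : ∀ᵐ x ∂μ, ‖g x‖ ≤ C)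
    (f : Lp 𝕜 1 μ) : ‖∫ x, g x * f x ∂μ‖ ≤ C * ‖f‖ := by
  rw [L1.norm_eq_integral_norm, ← integral_const_mul]
  refine norm_integral_le_of_norm_le ((L1.integrable_coeFn f).norm.const_mul C) ?_
  filter_upwards [hC] with x hx
  rw [norm_mul]
  exact mul_le_mul_of_nonneg_right hx (norm_nonneg _)

/-- The bounded functional on `L¹(μ)` given by integration against a bounded function. -/
noncomputable def integralMulCLM (μ : Measure Ω) {g : Ω → 𝕜} (hg : Measurable g) {C : ℝ}
    (hC : ∀ x, ‖g x‖ ≤ C) : Lp 𝕜 1 μ →L[𝕜] 𝕜 :=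
  LinearMap.mkContinuous
    { toFun := fun f => ∫ x, g x * f x ∂μ
      map_add' := fun f h => by
        rw [← integral_add (integrable_mul_L1 hg hC f) (integrable_mul_L1 hg hC h)]
        refine integral_congr_ae ?_
        filter_upwards [Lp.coeFn_add f h] with x hx
        rw [hx, Pi.add_apply, mul_add]
      map_smul' := fun c f => by
        rw [RingHom.id_apply, smul_eq_mul, ← integral_const_mul]
        refine integral_congr_ae ?_
        filter_upwards [Lp.coeFn_smul c f] with x hx
        rw [hx, Pi.smul_apply, smul_eq_mul, mul_left_comm] }
    C (norm_integral_mul_L1_le (.of_forall hC))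

theorem integralMulCLM_apply {g : Ω → 𝕜} (hg : Measurable g) {C : ℝ}
    (hC : ∀ x, ‖g x‖ ≤ C) (f : Lp 𝕜 1 μ) :
    integralMulCLM μ hg hC f = ∫ x, g x * f x ∂μ := rfl

variable [IsProbabilityMeasure μ]

variable (𝕜 μ) in
/-- The inclusion of `L²(μ)` into `L¹(μ)` for a probability measure. -/
noncomputable def inclL2L1 : Lp 𝕜 2 μ →L[𝕜] Lp 𝕜 1 μ :=
  LinearMap.mkContinuous
    { toFun := fun f => ((Lp.memLp f).mono_exponent (p := 1) (by norm_num)).toLp f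
      map_add' := fun f h => by
        rw [← MemLp.toLp_add, MemLp.toLp_eq_toLp_iff]
        exact Lp.coeFn_add f h
      map_smul' := fun c f => by
        rw [RingHom.id_apply, ← MemLp.toLp_const_smul, MemLp.toLp_eq_toLp_iff]
        exact Lp.coeFn_smul c f }
    1 (fun f => by
      rw [one_mul]
      change ‖MemLp.toLp _ ((Lp.memLp f).mono_exponent (p := 1) (by norm_num))‖ ≤ ‖f‖
      rw [Lp.norm_toLp, Lp.norm_def]
      exact ENNReal.toReal_mono (Lp.eLpNorm_ne_top f)
        (eLpNorm_le_eLpNorm_of_exponent_le (by norm_num) (Lp.aestronglyMeasurable f)))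

theorem inclL2L1_toLp {f : Ω → 𝕜} (hf : MemLp f 2 μ) (hf1 : MemLp f 1 μ) :
    inclL2L1 𝕜 μ (hf.toLp f) = hf1.toLp f := by
  change MemLp.toLp _ ((Lp.memLp (hf.toLp f)).mono_exponent (p := 1) (by norm_num)) = _
  rw [MemLp.toLp_eq_toLp_iff]
  exact hf.coeFn_toLp

/-- Bounded functionals on `L¹(μ)` are represented on `L²(μ)` by a square integrable function. -/
theorem exists_integral_mul_eq_of_memLp_two (ℓ : Lp 𝕜 1 μ →L[𝕜] 𝕜) :
    ∃ g : Ω → 𝕜, Measurable g ∧ MemLp g 2 μ ∧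
      ∀ (f : Ω → 𝕜) (_ : MemLp f 2 μ) (hf1 : MemLp f 1 μ),
        ℓ (hf1.toLp f) = ∫ x, g x * f x ∂μ := by
  set k : Lp 𝕜 2 μ := (InnerProductSpace.toDual 𝕜 (Lp 𝕜 2 μ)).symm (ℓ.comp (inclL2L1 𝕜 μ)) with hk
  refine ⟨fun x => starRingEnd 𝕜 (k x), ?_, (Lp.memLp k).star, fun f hf hf1 => ?_⟩
  · exact RCLike.continuous_conj.measurable.comp (Lp.stronglyMeasurable k).measurable
  · have h1 : inner 𝕜 k (hf.toLp f) = ℓ (hf1.toLp f) := by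
      rw [hk, InnerProductSpace.toDual_symm_apply, ContinuousLinearMap.comp_apply,
        inclL2L1_toLp hf hf1]
    rw [← h1, L2.inner_def]
    refine integral_congr_ae ?_
    filter_upwards [hf.coeFn_toLp] with x hx
    rw [hx, RCLike.inner_apply, mul_comm]

/-- Every bounded functional on `L¹(μ)` is given by integration against a function which is bounded
by the norm of the functional. -/
theorem exists_integral_mul_eq (ℓ : Lp 𝕜 1 μ →L[𝕜] 𝕜) :
    ∃ g : Ω → 𝕜, Measurable g ∧ (∀ x, ‖g x‖ ≤ ‖ℓ‖) ∧ ∀ f : Lp 𝕜 1 μ, ℓ f = ∫ x, g x * f x ∂μ := by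
  obtain ⟨k, hkm, hk2, hk⟩ := exists_integral_mul_eq_of_memLp_two ℓ
  set s : Set Ω := {x | ‖ℓ‖ < ‖k x‖} with hs
  have hsm : MeasurableSet s := measurableSet_lt measurable_const hkm.norm
  have hs0 : μ s = 0 := by
    -- Testing `ℓ` on the conjugate phase of `k`, cut off to `s`, gives `∫_s ‖k‖ ≤ ‖ℓ‖ μ(s)`,
    -- impossible if `μ s > 0`.
    by_contra hne
    have h1 := setIntegral_gt_gt (norm_nonneg ℓ)
      (hk2.integrable (by norm_num)).norm.integrableOn hne
    rw [← hs] at h1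
    set p : Ω → 𝕜 := s.indicator fun x => starRingEnd 𝕜 (k x) / ‖k x‖ with hp
    have hpm : Measurable p :=
      ((RCLike.continuous_conj.measurable.comp hkm).div
        (RCLike.continuous_ofReal.measurable.comp hkm.norm)).indicator hsm
    have hpb : ∀ x, ‖p x‖ ≤ s.indicator (fun _ => (1 : ℝ)) x := by
      intro x
      by_cases hx : x ∈ s
      · simp only [hp, Set.indicator_of_mem hx, norm_div, RCLike.norm_conj, RCLike.norm_ofReal,
          abs_norm]
        exact div_self_le_one _
      · simp [hp, hx]
    have hpb1 : ∀ x, ‖p x‖ ≤ 1 := fun x =>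
      (hpb x).trans (Set.indicator_le_self' (fun _ _ => zero_le_one) x)
    have hp1 : MemLp p 1 μ := .of_bound hpm.aestronglyMeasurable 1 (.of_forall hpb1)
    have hp2 : MemLp p 2 μ := .of_bound hpm.aestronglyMeasurable 1 (.of_forall hpb1)
    have h2 : ℓ (hp1.toLp p) = ((∫ x in s, ‖k x‖ ∂μ : ℝ) : 𝕜) := by
      rw [hk p hp2 hp1, ← integral_ofReal, ← integral_indicator hsm]
      congr 1
      ext x
      by_cases hx : x ∈ s
      · have hkx : (‖k x‖ : 𝕜) ≠ 0 := by
          have : 0 < ‖k x‖ := (norm_nonneg ℓ).trans_lt hx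
          exact_mod_cast this.ne'
        simp only [hp, Set.indicator_of_mem hx]
        rw [mul_div_assoc', RCLike.mul_conj]
        field_simp
      · simp [hp, hx]
    have h3 : ‖hp1.toLp p‖ ≤ μ.real s := by
      rw [L1.norm_eq_integral_norm]
      calc _ ≤ ∫ x, s.indicator (fun _ => (1 : ℝ)) x ∂μ := by
            refine integral_mono_ae (L1.integrable_coeFn _).norm
              ((integrable_const _).indicator hsm) ?_
            filter_upwards [hp1.coeFn_toLp] with x hx
            rw [hx]
            exact hpb x
        _ = μ.real s := by rw [integral_indicator hsm]; simp
    have h4 : ‖ℓ (hp1.toLp p)‖ ≤ ‖ℓ‖ * μ.real s :=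
      (ℓ.le_opNorm _).trans (by gcongr)
    rw [h2, RCLike.norm_ofReal] at h4
    have := (le_abs_self _).trans h4
    linarith
  have hkae : ∀ᵐ x ∂μ, sᶜ.indicator k x = k x := by
    filter_upwards [compl_mem_ae_iff.2 hs0] with x hx
    rw [Set.indicator_of_mem hx]
  have hbound : ∀ x, ‖sᶜ.indicator k x‖ ≤ ‖ℓ‖ := by
    intro x
    by_cases hx : x ∈ s
    · simp [hx]
    · rw [Set.indicator_of_mem (by exact hx)]
      exact not_lt.1 hx
  have hm : Measurable (sᶜ.indicator k) := hkm.indicator hsm.compl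
  refine ⟨sᶜ.indicator k, hm, hbound, fun f => ?_⟩
  rw [← integralMulCLM_apply hm hbound]
  induction f using Lp.induction ENNReal.one_ne_top with
  | indicatorConst c ht hμt =>
    rw [Lp.simpleFunc.coe_indicatorConst]
    have h2 : MemLp (Set.indicator _ fun _ => c) 2 μ :=
      memLp_indicator_const 2 ht c (Or.inr hμt.ne)
    refine (hk _ h2 (memLp_indicator_const 1 ht c (Or.inr hμt.ne))).trans ?_
    rw [integralMulCLM_apply]
    refine integral_congr_ae ?_
    filter_upwards [hkae, indicatorConstLp_coeFn (p := 1) (hs := ht) (hμs := hμt.ne) (c := c)]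
      with x h3 h4
    rw [h3, h4]
  | add hf hg _ h1 h2 => rw [map_add, map_add, h1, h2]
  | isClosed => exact isClosed_eq ℓ.continuous (ContinuousLinearMap.continuous _)

end L1Dual

/-! ### Shrinking sets of positive measure. -/

section Localization

variable {Ω : Type*} [MeasurableSpace Ω] {μ : Measure Ω}

/-- On a set of positive measure a measurable function is almost constant on a subset of positive
measure, up to any given error. -/
theorem exists_subset_dist_le {𝕜 : Type*} [RCLike 𝕜] {g : Ω → 𝕜} (hg : Measurable g) {D : Set Ω}
    (hD : MeasurableSet D) (hD0 : 0 < μ D) {ε : ℝ} (hε : 0 < ε) :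
    ∃ x₀ ∈ D, ∃ B ⊆ D, MeasurableSet B ∧ 0 < μ B ∧ ∀ x ∈ B, ‖g x - g x₀‖ ≤ ε := by
  -- The image measure charges `g '' D`, so some point of `g '' D` has only neighbourhoods of
  -- positive measure. Outer measure suffices here.
  have h1 : (μ.restrict D).map g (g '' D) ≠ 0 := by
    refine (lt_of_lt_of_le ?_ (Measure.le_map_apply hg.aemeasurable _)).ne'
    refine lt_of_lt_of_le ?_ (measure_mono (Set.subset_preimage_image g D))
    rwa [Measure.restrict_apply_self]
  obtain ⟨_, ⟨x₀, hx₀, rfl⟩, hpos⟩ := exists_mem_forall_mem_nhdsWithin_pos_measure h1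
  have h2 := hpos (Metric.closedBall (g x₀) ε)
    (mem_nhdsWithin_of_mem_nhds (Metric.closedBall_mem_nhds _ hε))
  have hBm : MeasurableSet (g ⁻¹' Metric.closedBall (g x₀) ε) :=
    hg Metric.isClosed_closedBall.measurableSet
  rw [Measure.map_apply hg Metric.isClosed_closedBall.measurableSet,
    Measure.restrict_apply hBm] at h2
  exact ⟨x₀, hx₀, _, Set.inter_subset_right, hBm.inter hD, h2, fun x hx => by
    simpa [dist_eq_norm] using hx.1⟩

/-- A set of positive measure for a non-atomic probability measure has subsets of arbitrarily small
positive measure. -/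
theorem IsNonAtomicMeasure.exists_subset_measure_lt [IsProbabilityMeasure μ]
    (hμ : IsNonAtomicMeasure μ) {A : Set Ω} (hA : MeasurableSet A) (hA0 : 0 < μ A) {ε : ℝ≥0∞}
    (hε : 0 < ε) : ∃ B ⊆ A, MeasurableSet B ∧ 0 < μ B ∧ μ B < ε := by
  have key : ∀ n : ℕ, ∃ B ⊆ A, MeasurableSet B ∧ 0 < μ B ∧ μ B ≤ 2⁻¹ ^ n := by
    intro n
    induction n with
    | zero => exact ⟨A, subset_rfl, hA, hA0, by simpa using prob_le_one⟩
    | succ n ih =>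
      obtain ⟨B, hBA, hB, hB0, hBn⟩ := ih
      have hhalf : 2⁻¹ * μ B ≤ 2⁻¹ ^ (n + 1) := by
        rw [pow_succ']
        gcongr
      -- One of `C`, `B \ C` has at most half the measure of `B`.
      obtain ⟨C, hCB, hC, hC0, hClt⟩ := hμ B hB hB0
      rcases le_total (μ C) (2⁻¹ * μ B) with hle | hle
      · exact ⟨C, hCB.trans hBA, hC, hC0, hle.trans hhalf⟩
      · have hdiff : μ (B \ C) = μ B - μ C :=
          measure_sdiff hCB hC.nullMeasurableSet (measure_ne_top μ C)
        refine ⟨B \ C, Set.sdiff_subset.trans hBA, hB.diff hC, ?_, ?_⟩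
        · rw [hdiff]
          exact tsub_pos_of_lt hClt
        · refine le_trans ?_ hhalf
          rw [hdiff, tsub_le_iff_right]
          calc μ B = 2⁻¹ * μ B + 2⁻¹ * μ B := by
                rw [← add_mul, ENNReal.inv_two_add_inv_two, one_mul]
            _ ≤ _ := by gcongr
  obtain ⟨n, hn⟩ := ENNReal.exists_inv_two_pow_lt hε.ne'
  obtain ⟨B, hBA, hB, hB0, hBn⟩ := key n
  exact ⟨B, hBA, hB, hB0, hBn.trans_lt hn⟩

/-- A set of positive measure for a non-atomic probability measure has a subset of positive measure
on which a given integrable function has a small integral. -/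
theorem IsNonAtomicMeasure.exists_subset_setIntegral_norm_le [IsProbabilityMeasure μ]
    (hμ : IsNonAtomicMeasure μ) {E : Type*} [NormedAddCommGroup E] {f : Ω → E}
    (hf : Integrable f μ) {A : Set Ω} (hA : MeasurableSet A) (hA0 : 0 < μ A) {ε : ℝ} (hε : 0 < ε) :
    ∃ B ⊆ A, MeasurableSet B ∧ 0 < μ B ∧ ∫ x in B, ‖f x‖ ∂μ ≤ ε := by
  obtain ⟨δ, hδ, h⟩ := exists_pos_setLIntegral_lt_of_measure_lt (μ := μ) (f := fun x => ‖f x‖ₑ)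
    hf.2.ne (ENNReal.ofReal_pos.2 hε).ne'
  obtain ⟨B, hBA, hB, hB0, hBδ⟩ := hμ.exists_subset_measure_lt hA hA0 hδ
  refine ⟨B, hBA, hB, hB0, ?_⟩
  rw [integral_norm_eq_lintegral_enorm hf.1.restrict]
  exact ENNReal.toReal_le_of_le_ofReal hε.le (h B hBδ).le

end Localization

/-! ### Annihilators of small subspaces. -/

section Annihilator

variable {𝕜 : Type*} [RCLike 𝕜] {Ω : Type*} [MeasurableSpace Ω] {μ : Measure Ω}

theorem projL1_mem_L1On {A : Set Ω} (hA : MeasurableSet A) (f : Lp 𝕜 1 μ) :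
    projL1 𝕜 μ hA f ∈ L1On 𝕜 μ A := by
  change ∀ᵐ x ∂μ, _
  filter_upwards [coeFn_projL1 hA f] with x hx hxA
  rw [hx, Set.indicator_of_notMem hxA]

theorem projL1_eq_self_of_mem {A : Set Ω} (hA : MeasurableSet A) {f : Lp 𝕜 1 μ}
    (hf : f ∈ L1On 𝕜 μ A) : projL1 𝕜 μ hA f = f := by
  refine Lp.ext ?_
  have hf' : ∀ᵐ x ∂μ, x ∉ A → f x = 0 := hf
  filter_upwards [coeFn_projL1 hA f, hf'] with x h1 h2
  by_cases hx : x ∈ A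
  · rw [h1, Set.indicator_of_mem hx]
  · rw [h1, Set.indicator_of_notMem hx, h2 hx]

theorem norm_projL1_le {A : Set Ω} (hA : MeasurableSet A) (f : Lp 𝕜 1 μ) :
    ‖projL1 𝕜 μ hA f‖ ≤ ‖f‖ := by
  rw [L1.norm_eq_integral_norm, L1.norm_eq_integral_norm]
  refine integral_mono_ae (L1.integrable_coeFn _).norm (L1.integrable_coeFn _).norm ?_
  filter_upwards [coeFn_projL1 hA f] with x hx
  rw [hx]
  exact norm_indicator_le_norm_self _ _

variable (𝕜 μ) in
/-- The projection `P_A` as a bounded operator onto `L¹(A)`. -/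
noncomputable def projL1CLM {A : Set Ω} (hA : MeasurableSet A) : Lp 𝕜 1 μ →L[𝕜] L1On 𝕜 μ A :=
  LinearMap.mkContinuous ((projL1 𝕜 μ hA).codRestrict (L1On 𝕜 μ A) (projL1_mem_L1On hA)) 1
    fun f => by
      rw [one_mul]
      exact norm_projL1_le hA f

theorem coe_projL1CLM {A : Set Ω} (hA : MeasurableSet A) (f : Lp 𝕜 1 μ) :
    (projL1CLM 𝕜 μ hA f : Lp 𝕜 1 μ) = projL1 𝕜 μ hA f := rfl

theorem projL1CLM_coe {A : Set Ω} (hA : MeasurableSet A) (f : L1On 𝕜 μ A) :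
    projL1CLM 𝕜 μ hA f = f := Subtype.ext (projL1_eq_self_of_mem hA f.2)

theorem norm_projL1CLM_le {A : Set Ω} (hA : MeasurableSet A) : ‖projL1CLM 𝕜 μ hA‖ ≤ 1 :=
  LinearMap.mkContinuous_norm_le _ zero_le_one _

variable [IsProbabilityMeasure μ]

/-- If `P_A` does not map `Z` onto `L¹(A)`, then some bounded function which annihilates `Z` is
concentrated on `A` up to a small error and almost constant on a subset of `A`. -/
theorem exists_annihilator_bump {Z : Submodule 𝕜 (Lp 𝕜 1 μ)} (hZ : IsClosed (Z : Set (Lp 𝕜 1 μ)))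
    {A : Set Ω} (hA : MeasurableSet A) (hZA : Z.map (projL1 𝕜 μ hA) ≠ L1On 𝕜 μ A) {δ : ℝ}
    (hδ : 0 < δ) :
    ∃ φ : Ω → 𝕜, Measurable φ ∧ (∀ x, ‖φ x‖ ≤ 1) ∧ (∀ x ∉ A, ‖φ x‖ ≤ δ) ∧
      (∀ z ∈ Z, ∫ x, φ x * z x ∂μ = 0) ∧
      ∃ B ⊆ A, MeasurableSet B ∧ 0 < μ B ∧ ∀ x ∈ B, ‖φ x - 1‖ ≤ δ := by
  have : CompleteSpace Z := hZ.completeSpace_coe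
  set γ : ℝ := min (δ / 4) (1 / 2) with hγ
  have hγ0 : 0 < γ := by positivity
  -- Four errors of size `γ` occur on `B`: oscillation of `g`, distance of `‖g x₀‖` from `1`, the
  -- correction `k`, and the normalization `1 + γ`.
  have hγδ : 4 * γ ≤ δ := by linarith [min_le_left (δ / 4) (1 / 2)]
  have hγ1 : γ ≤ 1 / 2 := min_le_right _ _
  set P := projL1CLM 𝕜 μ hA with hP
  set T : Z →L[𝕜] L1On 𝕜 μ A := P.comp Z.subtypeL with hT
  have hTs : ¬ Function.Surjective T := by
    intro hs
    refine hZA (le_antisymm ?_ fun f hf => ?_)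
    · rintro _ ⟨z, -, rfl⟩
      exact projL1_mem_L1On hA z
    · obtain ⟨z, hz⟩ := hs ⟨f, hf⟩
      exact ⟨z, z.2, congrArg Subtype.val hz⟩
  obtain ⟨ℓ, hℓ, hℓT⟩ := T.exists_norm_comp_le_of_not_surjective hTs hγ0
  obtain ⟨g₀, hg₀m, hg₀b, hg₀⟩ := exists_integral_mul_eq (ℓ.comp P)
  -- `ψ` agrees with `ℓ ∘ P` on `Z` and has norm at most `γ`, so subtracting its density `k` makes
  -- `g` annihilate `Z` at small cost.
  obtain ⟨ψ, hψ, hψn⟩ := exists_extension_norm_eq Z (ℓ.comp T)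
  obtain ⟨k, hkm, hkb, hk⟩ := exists_integral_mul_eq ψ
  rw [hψn] at hkb
  replace hkb : ∀ x, ‖k x‖ ≤ γ := fun x => (hkb x).trans hℓT
  have hℓP : ‖ℓ.comp P‖ ≤ 1 := (ContinuousLinearMap.opNorm_comp_le _ _).trans (by
    rw [hℓ, one_mul]
    exact norm_projL1CLM_le hA)
  set g : Ω → 𝕜 := A.indicator g₀ with hg
  have hgm : Measurable g := hg₀m.indicator hA
  have hgb : ∀ x, ‖g x‖ ≤ 1 := fun x =>
    (norm_indicator_le_norm_self _ _).trans ((hg₀b x).trans hℓP)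
  have hgint : ∀ f : Lp 𝕜 1 μ, ∫ x, g x * f x ∂μ = ℓ (P f) := by
    intro f
    have h1 := hg₀ (P f)
    rw [ContinuousLinearMap.comp_apply, projL1CLM_coe] at h1
    rw [h1]
    refine integral_congr_ae ?_
    filter_upwards [coeFn_projL1 hA f] with x hx
    rw [coe_projL1CLM, hx]
    by_cases hxA : x ∈ A <;> simp [hg, hxA]
  set D : Set Ω := {x | 1 - γ < ‖g x‖} with hD
  have hDm : MeasurableSet D := measurableSet_lt measurable_const hgm.norm
  have hDA : D ⊆ A := by
    intro x hx
    by_contra hxA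
    have : 1 - γ < ‖g x‖ := hx
    rw [hg, Set.indicator_of_notMem hxA, norm_zero] at this
    linarith
  have hD0 : 0 < μ D := by
    rw [pos_iff_ne_zero]
    intro h0
    have hae : ∀ᵐ x ∂μ, ‖g x‖ ≤ 1 - γ := by
      filter_upwards [compl_mem_ae_iff.2 h0] with x hx
      exact not_lt.1 hx
    have : ‖ℓ‖ ≤ 1 - γ := ℓ.opNorm_le_bound (by linarith) fun f => by
      have h1 := norm_integral_mul_L1_le hae (f : Lp 𝕜 1 μ)
      rwa [hgint, projL1CLM_coe] at h1
    linarith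
  obtain ⟨x₀, hx₀, B, hBD, hB, hB0, hBg⟩ := exists_subset_dist_le hgm hDm hD0 hγ0
  obtain ⟨u, hu, hug⟩ := RCLike.exists_norm_eq_mul_self (g x₀)
  have hs : ‖(((1 + γ)⁻¹ : ℝ) : 𝕜)‖ = (1 + γ)⁻¹ := by
    rw [RCLike.norm_ofReal, abs_of_pos (by positivity)]
  have hss : (((1 + γ)⁻¹ : ℝ) : 𝕜) * (1 + (γ : 𝕜)) = 1 := by
    have h1 : (1 + γ)⁻¹ * (1 + γ) = 1 := inv_mul_cancel₀ (by positivity)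
    exact_mod_cast congrArg (RCLike.ofReal : ℝ → 𝕜) h1
  have hbound : ∀ x (C : ℝ), ‖g x‖ ≤ C →
      ‖(((1 + γ)⁻¹ : ℝ) : 𝕜) * (u * (g x - k x))‖ ≤ (1 + γ)⁻¹ * (C + γ) := fun x C hC => by
    rw [norm_mul, norm_mul, hs, hu, one_mul]
    gcongr
    exact (norm_sub_le _ _).trans (add_le_add hC (hkb x))
  refine ⟨fun x => (((1 + γ)⁻¹ : ℝ) : 𝕜) * (u * (g x - k x)),
    ((hgm.sub hkm).const_mul u).const_mul _, fun x => ?_, fun x hx => ?_, fun z hz => ?_,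
    B, hBD.trans hDA, hB, hB0, fun x hx => ?_⟩
  · refine (hbound x 1 (hgb x)).trans_eq ?_
    exact inv_mul_cancel₀ (by positivity)
  · refine (hbound x 0 (by simp [hg, hx])).trans ?_
    rw [inv_mul_le_iff₀ (by positivity)]
    nlinarith
  · have h1 : ∫ x, g x * z x ∂μ = ∫ x, k x * z x ∂μ := by
      rw [hgint, ← hk, hψ ⟨z, hz⟩]
      rfl
    have h2 : ∀ x, (((1 + γ)⁻¹ : ℝ) : 𝕜) * (u * (g x - k x)) * z x =
        ((((1 + γ)⁻¹ : ℝ) : 𝕜) * u) * (g x * z x - k x * z x) := fun x => by ring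
    simp_rw [h2]
    rw [integral_const_mul, integral_sub (integrable_mul_L1 hgm hgb z)
      (integrable_mul_L1 hkm hkb z), h1, sub_self, mul_zero]
  · have h1 : (((1 + γ)⁻¹ : ℝ) : 𝕜) * (u * (g x - k x)) - 1 = (((1 + γ)⁻¹ : ℝ) : 𝕜) *
        (u * (g x - g x₀) + ((‖g x₀‖ - 1 : ℝ) : 𝕜) - u * k x - (γ : 𝕜)) := by
      rw [RCLike.ofReal_sub, RCLike.ofReal_one, hug]
      linear_combination hss
    have h2 : |‖g x₀‖ - 1| ≤ γ := by
      have h3 : 1 - γ < ‖g x₀‖ := hx₀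
      rw [abs_le]
      constructor <;> linarith [hgb x₀]
    rw [h1, norm_mul, hs, inv_mul_le_iff₀ (by positivity)]
    have h4 : ‖u * (g x - g x₀)‖ ≤ γ := by rw [norm_mul, hu, one_mul]; exact hBg x hx
    have h5 : ‖((‖g x₀‖ - 1 : ℝ) : 𝕜)‖ ≤ γ := by rwa [RCLike.norm_ofReal]
    have h6 : ‖u * k x‖ ≤ γ := by rw [norm_mul, hu, one_mul]; exact hkb x
    have h7 : ‖(γ : 𝕜)‖ = γ := by rw [RCLike.norm_ofReal, abs_of_pos hγ0]
    have h8 := norm_sub_le (u * (g x - g x₀) + ((‖g x₀‖ - 1 : ℝ) : 𝕜) - u * k x) (γ : 𝕜)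
    have h9 := norm_sub_le (u * (g x - g x₀) + ((‖g x₀‖ - 1 : ℝ) : 𝕜)) (u * k x)
    have h10 := norm_add_le (u * (g x - g x₀)) ((‖g x₀‖ - 1 : ℝ) : 𝕜)
    nlinarith

/-- If `P_A` does not map `Z` onto `L¹(A)` for any `A` of positive measure, then some bounded
function which annihilates `Z` is close to `0` outside of `A`, takes values close to a given segment,
and is close to the end point of the segment on a subset of `A` of positive measure. -/
theorem exists_annihilator_near_segment {Z : Submodule 𝕜 (Lp 𝕜 1 μ)}
    (hZ : IsClosed (Z : Set (Lp 𝕜 1 μ))) (hsmall : IsSmallSubspace Z) {A : Set Ω}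
    (hA : MeasurableSet A) (hA0 : 0 < μ A) {η : ℝ} {d : 𝕜} (hd : ‖d‖ ≤ η) (n : ℕ) {δ : ℝ}
    (hδ : 0 < δ) :
    ∃ φ : Ω → 𝕜, Measurable φ ∧ (∀ z ∈ Z, ∫ x, φ x * z x ∂μ = 0) ∧ (∀ x ∉ A, ‖φ x‖ ≤ δ) ∧
      (∀ x, ∃ t : ℝ, 0 ≤ t ∧ t ≤ n ∧ ‖φ x - (t : 𝕜) * d‖ ≤ η + δ) ∧
      ∃ B ⊆ A, MeasurableSet B ∧ 0 < μ B ∧ ∀ x ∈ B, ‖φ x - (n : 𝕜) * d‖ ≤ δ := by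
  have hη : 0 ≤ η := (norm_nonneg d).trans hd
  induction n generalizing δ with
  | zero =>
    exact ⟨fun _ => 0, measurable_const, by simp, by simp [hδ.le],
      fun _ => ⟨0, le_rfl, by simp, by simpa using by positivity⟩, A, subset_rfl, hA, hA0,
      by simp [hδ.le]⟩
  | succ n ih =>
    obtain ⟨φ, hφm, hφZ, hφA, hφt, B, hBA, hB, hB0, hφB⟩ := ih (half_pos hδ)
    have hε : 0 < δ / (2 * (η + 1)) := by positivity
    have hε' : η * (δ / (2 * (η + 1))) ≤ δ / 2 := by
      rw [mul_div_assoc', div_le_div_iff₀ (by positivity) (by positivity)]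
      nlinarith
    -- The new bump sits on `B`, where `φ ≈ n d`: on `B` the step `d * β` has size at most `η`, and
    -- off `B` it costs only `δ / 2`.
    obtain ⟨β, hβm, hβ1, hβB, hβZ, B', hB'B, hB', hB'0, hβB'⟩ :=
      exists_annihilator_bump hZ hB (fun h => hsmall ⟨B, hB, hB0, h⟩) hε
    have hφb : ∀ x, ‖φ x‖ ≤ n * η + (η + δ / 2) := by
      intro x
      obtain ⟨t, ht0, htn, ht⟩ := hφt x
      have h1 : ‖(t : 𝕜) * d‖ ≤ n * η := by
        rw [norm_mul, RCLike.norm_ofReal, abs_of_nonneg ht0]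
        gcongr
      have h2 := norm_add_le (φ x - (t : 𝕜) * d) ((t : 𝕜) * d)
      rw [sub_add_cancel] at h2
      linarith
    have hdβ : ∀ (C : ℝ) (y : 𝕜), ‖y‖ ≤ C → ‖d * y‖ ≤ η * C := fun C y h => by
      rw [norm_mul]
      gcongr
    have hβout : ∀ x ∉ B, ‖d * β x‖ ≤ δ / 2 := fun x hx =>
      (hdβ _ _ (hβB x hx)).trans hε'
    refine ⟨fun x => φ x + d * β x, hφm.add (hβm.const_mul d), fun z hz => ?_, fun x hx => ?_,
      fun x => ?_, B', hB'B.trans hBA, hB', hB'0, fun x hx => ?_⟩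
    · simp_rw [add_mul, mul_assoc]
      rw [integral_add (integrable_mul_L1 hφm hφb z)
        ((integrable_mul_L1 hβm hβ1 z).const_mul d), integral_const_mul, hφZ z hz, hβZ z hz,
        mul_zero, add_zero]
    · refine (norm_add_le _ _).trans ?_
      linarith [hφA x hx, hβout x fun h => hx (hBA h)]
    · by_cases hx : x ∈ B
      · refine ⟨n, Nat.cast_nonneg n, by push_cast; linarith, ?_⟩
        have h1 := hφB x hx
        have h2 := hdβ 1 _ (hβ1 x)
        have h3 := norm_add_le (φ x - (n : 𝕜) * d) (d * β x)
        rw [RCLike.ofReal_natCast, add_sub_right_comm]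
        linarith
      · obtain ⟨t, ht0, htn, ht⟩ := hφt x
        refine ⟨t, ht0, by push_cast; linarith, ?_⟩
        have h2 := hβout x hx
        have h3 := norm_add_le (φ x - (t : 𝕜) * d) (d * β x)
        rw [add_sub_right_comm]
        linarith
    · have h1 := hφB x (hB'B hx)
      have h2 := (hdβ _ _ (hβB' x hx)).trans hε'
      have h3 := norm_add_le (φ x - (n : 𝕜) * d) (d * (β x - 1))
      have h4 : φ x + d * β x - ((n + 1 : ℕ) : 𝕜) * d =
          φ x - (n : 𝕜) * d + d * (β x - 1) := by push_cast; ring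
      rw [h4]
      linarith

end Annihilator

/-! ### The Daugavet property of the quotient. -/

section Quotient

variable {𝕜 : Type*} [RCLike 𝕜] {Ω : Type*} [MeasurableSpace Ω] {μ : Measure Ω}

/-- A function which annihilates the kernel of a quotient map bounds the quotient norm from
below. -/
theorem norm_integral_mul_le_of_quotient {E : Type*} [NormedAddCommGroup E] [NormedSpace 𝕜 E]
    {Z : Submodule 𝕜 (Lp 𝕜 1 μ)} (π : Lp 𝕜 1 μ →L[𝕜] E)
    (hlift : ∀ e, ∀ δ : ℝ, 0 < δ → ∃ f, π f = e ∧ ‖f‖ < ‖e‖ + δ)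
    (hker : ∀ f, π f = 0 → f ∈ Z) {g : Ω → 𝕜} (hg : Measurable g) {C C' : ℝ} (hC0 : 0 ≤ C)
    (hC' : ∀ x, ‖g x‖ ≤ C') (hC : ∀ᵐ x ∂μ, ‖g x‖ ≤ C) (hgZ : ∀ z ∈ Z, ∫ x, g x * z x ∂μ = 0)
    (f : Lp 𝕜 1 μ) : ‖∫ x, g x * f x ∂μ‖ ≤ C * ‖π f‖ := by
  refine le_of_forall_pos_le_add fun ε hε => ?_
  -- The integral depends only on `π f`, so `f` may be replaced by an almost norm-minimal lift.
  obtain ⟨f', hf', hlt⟩ := hlift (π f) (ε / (C + 1)) (by positivity)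
  have h1 := hgZ (f - f') (hker _ (by rw [map_sub, hf', sub_self]))
  rw [← integralMulCLM_apply hg hC', map_sub, sub_eq_zero] at h1
  rw [← integralMulCLM_apply hg hC', h1, integralMulCLM_apply]
  have h2 : C * (ε / (C + 1)) ≤ ε := by
    rw [mul_div_assoc', div_le_iff₀ (by positivity)]
    nlinarith
  calc _ ≤ C * ‖f'‖ := norm_integral_mul_L1_le hC f'
    _ ≤ C * (‖π f‖ + ε / (C + 1)) := by gcongr
    _ ≤ _ := by linarith

variable [IsProbabilityMeasure μ]

/-- For a set `B` of positive measure and a scalar `c` there is a normalized function `h` supported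
on `B` which integrates every function with values near `c` on `B` approximately to `‖c‖`. -/
theorem exists_norm_le_one_norm_integral_sub_le {B : Set Ω} (hB : MeasurableSet B) (hB0 : 0 < μ B)
    (c : 𝕜) :
    ∃ h : Lp 𝕜 1 μ, ‖h‖ ≤ 1 ∧ ∀ (k : Ω → 𝕜) (C r : ℝ), Measurable k → (∀ x, ‖k x‖ ≤ C) → 0 ≤ r →
      (∀ x ∈ B, ‖k x - c‖ ≤ r) → ‖∫ x, k x * h x ∂μ - (‖c‖ : 𝕜)‖ ≤ r := by
  obtain ⟨u, hu, huc⟩ := RCLike.exists_norm_eq_mul_self c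
  have hb : 0 < μ.real B := ENNReal.toReal_pos hB0.ne' (measure_ne_top μ B)
  have hb' : ((μ.real B : ℝ) : 𝕜) ≠ 0 := by exact_mod_cast hb.ne'
  -- `h` depends on `B` and `c` alone, so one `h` serves both `g` and `g₀` later.
  set h : Lp 𝕜 1 μ := indicatorConstLp 1 hB (measure_ne_top μ B) (u / (μ.real B : 𝕜)) with hh
  have hh1 : ‖h‖ = 1 := by
    rw [hh, norm_indicatorConstLp one_ne_zero ENNReal.one_ne_top, norm_div, hu,
      RCLike.norm_ofReal, abs_of_pos hb]
    simp [hb.ne']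
  have hhx : ∀ᵐ x ∂μ, h x = B.indicator (fun _ => u / (μ.real B : 𝕜)) x := indicatorConstLp_coeFn
  refine ⟨h, hh1.le, fun k C r hk hkC hr hkB => ?_⟩
  have hc : ∫ x, c * h x ∂μ = (‖c‖ : 𝕜) := by
    rw [integral_const_mul, integral_congr_ae hhx, integral_indicator hB, setIntegral_const,
      huc, RCLike.real_smul_eq_coe_mul]
    field_simp
  have hint : ∫ x, k x * h x ∂μ - (‖c‖ : 𝕜) =
      ∫ x, B.indicator (fun x => k x - c) x * h x ∂μ := by
    rw [← hc, ← integral_sub (integrable_mul_L1 hk hkC h)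
      ((L1.integrable_coeFn h).const_mul c)]
    refine integral_congr_ae ?_
    filter_upwards [hhx] with x hx
    rw [hx]
    by_cases hxB : x ∈ B <;> simp [hxB, sub_mul]
  rw [hint]
  refine (norm_integral_mul_L1_le (.of_forall fun x => ?_) h).trans_eq (by rw [hh1, mul_one])
  by_cases hxB : x ∈ B
  · rw [Set.indicator_of_mem hxB]
    exact hkB x hxB
  · rw [Set.indicator_of_notMem hxB, norm_zero]
    exact hr

-- Lets an annihilator be changed substantially on a set carrying little mass of `f` while hardly
-- moving its integral against `f`.
omit [IsProbabilityMeasure μ] in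
theorem norm_integral_mul_le_of_small_outside {φ : Ω → 𝕜} {f : Lp 𝕜 1 μ} {A : Set Ω}
    (hA : MeasurableSet A) {η C τ : ℝ} (hC0 : 0 ≤ C) (hη : 0 ≤ η) (hC : ∀ x, ‖φ x‖ ≤ C)
    (hout : ∀ x ∉ A, ‖φ x‖ ≤ η) (hf : ∫ x in A, ‖f x‖ ∂μ ≤ τ) :
    ‖∫ x, φ x * f x ∂μ‖ ≤ η * ‖f‖ + C * τ := by
  have hfi := (L1.integrable_coeFn f).norm
  calc _ ≤ ∫ x, (η * ‖f x‖ + C * A.indicator (fun x => ‖f x‖) x) ∂μ := by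
        refine norm_integral_le_of_norm_le
          ((hfi.const_mul η).add ((hfi.indicator hA).const_mul C)) (.of_forall fun x => ?_)
        rw [norm_mul]
        by_cases hx : x ∈ A
        · rw [Set.indicator_of_mem hx]
          have := mul_le_mul_of_nonneg_right (hC x) (norm_nonneg (f x))
          have := mul_nonneg hη (norm_nonneg (f x))
          linarith
        · rw [Set.indicator_of_notMem hx, mul_zero, add_zero]
          exact mul_le_mul_of_nonneg_right (hout x hx) (norm_nonneg _)
    _ = η * ‖f‖ + C * ∫ x in A, ‖f x‖ ∂μ := by
        rw [integral_add (hfi.const_mul η) ((hfi.indicator hA).const_mul C), integral_const_mul,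
          integral_const_mul, integral_indicator hA, L1.norm_eq_integral_norm]
    _ ≤ _ := by gcongr

/-- Given an annihilator `g₁` of `Z` in the unit ball, there is another one which integrates `f` to
almost the same value and which is close to a given value `c` on a set of positive measure. -/
theorem exists_annihilator_near_const (hμ : IsNonAtomicMeasure μ) {Z : Submodule 𝕜 (Lp 𝕜 1 μ)}
    (hZ : IsClosed (Z : Set (Lp 𝕜 1 μ))) (hsmall : IsSmallSubspace Z) {g₁ : Ω → 𝕜}
    (hg₁ : Measurable g₁) (hg₁b : ∀ x, ‖g₁ x‖ ≤ 1) (hg₁Z : ∀ z ∈ Z, ∫ x, g₁ x * z x ∂μ = 0)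
    (f : Lp 𝕜 1 μ) {D : Set Ω} (hD : MeasurableSet D) (hD0 : 0 < μ D) {c : 𝕜} (hc : ‖c‖ ≤ 1)
    {η : ℝ} (hη : 0 < η) (hη3 : η ≤ 1 / 3) :
    ∃ g : Ω → 𝕜, Measurable g ∧ (∀ x, ‖g x‖ ≤ 1) ∧ (∀ z ∈ Z, ∫ x, g x * z x ∂μ = 0) ∧
      ‖∫ x, g x * f x ∂μ - ∫ x, g₁ x * f x ∂μ‖ ≤ η * (4 + 4 * ‖f‖) ∧
      ∃ B ⊆ D, MeasurableSet B ∧ 0 < μ B ∧ ∀ x ∈ B, ‖g x - c‖ ≤ 5 * η := by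
  obtain ⟨D₁, hD₁D, hD₁, hD₁0, hfD₁⟩ :=
    hμ.exists_subset_setIntegral_norm_le (L1.integrable_coeFn f) hD hD0 hη
  obtain ⟨x₁, -, A, hAD₁, hA, hA0, hAg₁⟩ := exists_subset_dist_le hg₁ hD₁ hD₁0 hη
  have hfA : ∫ x in A, ‖f x‖ ∂μ ≤ η :=
    (setIntegral_mono_set (L1.integrable_coeFn f).norm.integrableOn
      (.of_forall fun _ => norm_nonneg _) (.of_forall hAD₁)).trans hfD₁
  set c₁ := g₁ x₁ with hc₁
  have hc₁1 : ‖c₁‖ ≤ 1 := hg₁b x₁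
  obtain ⟨n, hn⟩ := exists_nat_gt (2 / η)
  have hn0 : (0 : ℝ) < n := (by positivity : 0 < 2 / η).trans hn
  have hn0' : (n : 𝕜) ≠ 0 := by exact_mod_cast hn0.ne'
  -- Scaling `g₁` by `ρ` leaves room for two errors on `A`: `η` from `g₁ ≈ c₁` and `2η` from the
  -- distance of `φ` to the segment.
  set ρ : ℝ := 1 - 3 * η with hρ
  have hρ0 : 0 ≤ ρ := by linarith
  have hρ1 : ρ ≤ 1 := by linarith
  have hρn : ‖(ρ : 𝕜)‖ = ρ := by rw [RCLike.norm_ofReal, abs_of_nonneg hρ0]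
  set d : 𝕜 := (ρ : 𝕜) * (c - c₁) / n with hd
  have hnd : (n : 𝕜) * d = (ρ : 𝕜) * (c - c₁) := by rw [hd]; field_simp
  have hcc₁ : ‖(ρ : 𝕜) * (c - c₁)‖ ≤ 2 := by
    rw [norm_mul, hρn]
    have := norm_sub_le c c₁
    have := norm_nonneg (c - c₁)
    nlinarith
  have hdη : ‖d‖ ≤ η := by
    rw [hd, norm_div, RCLike.norm_natCast, div_le_iff₀ hn0]
    rw [div_lt_iff₀ hη] at hn
    linarith
  obtain ⟨φ, hφm, hφZ, hφA, hφt, B, hBA, hB, hB0, hφB⟩ :=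
    exists_annihilator_near_segment hZ hsmall hA hA0 hdη n hη
  have hφ4 : ∀ x, ‖φ x‖ ≤ 4 := by
    intro x
    obtain ⟨t, ht0, htn, ht⟩ := hφt x
    have h1 : ‖(t : 𝕜) * d‖ ≤ 2 := by
      refine le_trans ?_ hcc₁
      rw [← hnd, norm_mul, norm_mul, RCLike.norm_ofReal, abs_of_nonneg ht0, RCLike.norm_natCast]
      gcongr
    have h2 := norm_add_le (φ x - (t : 𝕜) * d) ((t : 𝕜) * d)
    rw [sub_add_cancel] at h2
    linarith
  have hρg₁ : ∀ x, ‖(ρ : 𝕜) * g₁ x‖ ≤ ρ := fun x => by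
    rw [norm_mul, hρn]
    exact mul_le_of_le_one_right hρ0 (hg₁b x)
  have hnear : ∀ x ∈ A, ‖(ρ : 𝕜) * (g₁ x - c₁)‖ ≤ η := fun x hx => by
    rw [norm_mul, hρn]
    exact (mul_le_of_le_one_left (norm_nonneg _) hρ1).trans (hAg₁ x hx)
  have hint : ∀ h : Lp 𝕜 1 μ, ∫ x, ((ρ : 𝕜) * g₁ x + φ x) * h x ∂μ =
      (ρ : 𝕜) * ∫ x, g₁ x * h x ∂μ + ∫ x, φ x * h x ∂μ := fun h => by
    simp_rw [add_mul, mul_assoc]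
    rw [integral_add ((integrable_mul_L1 hg₁ hg₁b h).const_mul _) (integrable_mul_L1 hφm hφ4 h),
      integral_const_mul]
  refine ⟨fun x => (ρ : 𝕜) * g₁ x + φ x, (hg₁.const_mul _).add hφm, fun x => ?_, fun z hz => ?_,
    ?_, B, hBA.trans (hAD₁.trans hD₁D), hB, hB0, fun x hx => ?_⟩
  · by_cases hx : x ∈ A
    · obtain ⟨t, ht0, htn, ht⟩ := hφt x
      set s : ℝ := t / n with hs
      have hs0 : 0 ≤ s := by positivity
      have hs1 : s ≤ 1 := (div_le_one hn0).2 htn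
      have htd : (t : 𝕜) * d = (ρ : 𝕜) * ((s : 𝕜) * (c - c₁)) := by
        have : (t : 𝕜) = (s : 𝕜) * n := by
          rw [hs, RCLike.ofReal_div, RCLike.ofReal_natCast]
          field_simp
        rw [this, mul_assoc, hnd]
        ring
      -- The middle term is `ρ` times a convex combination of `c₁` and `c`, so its norm is at most
      -- `ρ`.
      have h1 : (ρ : 𝕜) * g₁ x + φ x = (ρ : 𝕜) * (g₁ x - c₁) +
          (ρ : 𝕜) * (((1 - s : ℝ) : 𝕜) * c₁ + (s : 𝕜) * c) + (φ x - (t : 𝕜) * d) := by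
        have h0 : ((1 - s : ℝ) : 𝕜) = 1 - s := by push_cast; rfl
        rw [htd, h0]
        ring
      have h2 : ‖(ρ : 𝕜) * (((1 - s : ℝ) : 𝕜) * c₁ + (s : 𝕜) * c)‖ ≤ ρ := by
        rw [norm_mul, hρn]
        refine mul_le_of_le_one_right hρ0 ((norm_add_le _ _).trans ?_)
        rw [norm_mul, norm_mul, RCLike.norm_ofReal, RCLike.norm_ofReal, abs_of_nonneg hs0,
          abs_of_nonneg (by linarith)]
        nlinarith
      beta_reduce
      rw [h1]
      refine (norm_add₃_le).trans ?_
      linarith [hnear x hx]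
    · refine (norm_add_le _ _).trans ?_
      linarith [hρg₁ x, hφA x hx]
  · rw [hint, hg₁Z z hz, hφZ z hz, mul_zero, add_zero]
  · rw [hint]
    have h1 := norm_integral_mul_le_of_small_outside hA (by norm_num) hη.le hφ4 hφA hfA
    have h2 := norm_integral_mul_L1_le (.of_forall hg₁b) f
    have h3 : (ρ : 𝕜) * ∫ x, g₁ x * f x ∂μ + ∫ x, φ x * f x ∂μ - ∫ x, g₁ x * f x ∂μ =
        ∫ x, φ x * f x ∂μ - ((3 * η : ℝ) : 𝕜) * ∫ x, g₁ x * f x ∂μ := by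
      rw [hρ, RCLike.ofReal_sub, RCLike.ofReal_one]
      ring
    have h4 : ‖((3 * η : ℝ) : 𝕜) * ∫ x, g₁ x * f x ∂μ‖ ≤ 3 * η * ‖f‖ := by
      rw [norm_mul, RCLike.norm_ofReal, abs_of_nonneg (by positivity)]
      gcongr
      linarith
    rw [h3]
    refine (norm_sub_le _ _).trans ?_
    linarith
  · have h1 : (ρ : 𝕜) * g₁ x + φ x - c =
        (ρ : 𝕜) * (g₁ x - c₁) + (φ x - (n : 𝕜) * d) - ((3 * η : ℝ) : 𝕜) * c := by
      rw [hnd, hρ, RCLike.ofReal_sub, RCLike.ofReal_one]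
      ring
    have h2 : ‖((3 * η : ℝ) : 𝕜) * c‖ ≤ 3 * η := by
      rw [norm_mul, RCLike.norm_ofReal, abs_of_nonneg (by positivity)]
      exact mul_le_of_le_one_right (by positivity) hc
    beta_reduce
    rw [h1]
    refine (norm_sub_le _ _).trans ?_
    have h3 := norm_add_le ((ρ : 𝕜) * (g₁ x - c₁)) (φ x - (n : 𝕜) * d)
    linarith [hnear x (hBA hx), hφB x hx]

/-- A quotient of `L¹(μ)` by a small closed subspace has the Daugavet property, where the quotient
is given by a map `π` whose kernel is the subspace. -/
theorem hasDaugavetProperty_of_isSmallSubspace_ker (hμ : IsNonAtomicMeasure μ)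
    {Z : Submodule 𝕜 (Lp 𝕜 1 μ)} (hZ : IsClosed (Z : Set (Lp 𝕜 1 μ)))
    (hsmall : IsSmallSubspace Z) {E : Type*} [NormedAddCommGroup E] [NormedSpace 𝕜 E]
    (π : Lp 𝕜 1 μ →L[𝕜] E) (hπ : ∀ f, ‖π f‖ ≤ ‖f‖)
    (hlift : ∀ e, ∀ δ : ℝ, 0 < δ → ∃ f, π f = e ∧ ‖f‖ < ‖e‖ + δ)
    (hker : ∀ f, π f = 0 ↔ f ∈ Z) : HasDaugavetProperty 𝕜 E := by
  refine hasDaugavetProperty_of_forall_exists fun ℓ e hℓ he ε hε => ?_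
  have hquot := @norm_integral_mul_le_of_quotient 𝕜 _ Ω _ μ E _ _ Z π hlift fun f => (hker f).1
  have hrep : ∀ ℓ' : E →L[𝕜] 𝕜, ‖ℓ'‖ = 1 → ∃ g : Ω → 𝕜, Measurable g ∧ (∀ x, ‖g x‖ ≤ 1) ∧
      ∀ f : Lp 𝕜 1 μ, ℓ' (π f) = ∫ x, g x * f x ∂μ := by
    intro ℓ' hℓ'
    obtain ⟨g, hg, hgb, hgi⟩ := exists_integral_mul_eq (ℓ'.comp π)
    have h1 : ‖ℓ'.comp π‖ ≤ 1 := by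
      refine (ℓ'.comp π).opNorm_le_bound zero_le_one fun f => ?_
      refine (ℓ'.le_opNorm _).trans ?_
      rw [hℓ']
      gcongr
      exact hπ f
    exact ⟨g, hg, fun x => (hgb x).trans h1, hgi⟩
  obtain ⟨ℓ₁, hℓ₁, hℓ₁e⟩ := exists_dual_vector 𝕜 e (by rw [he]; exact one_ne_zero)
  obtain ⟨f, rfl, -⟩ := hlift e 1 one_pos
  obtain ⟨g₁, hg₁, hg₁b, hg₁i⟩ := hrep ℓ₁ hℓ₁
  obtain ⟨g₀, hg₀, hg₀b, hg₀i⟩ := hrep ℓ hℓ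
  have hZ0 : ∀ z ∈ Z, π z = 0 := fun z hz => (hker z).2 hz
  have hg₁f : ∫ x, g₁ x * f x ∂μ = 1 := by rw [← hg₁i, hℓ₁e, he, RCLike.ofReal_one]
  -- The error `4 + 4‖f‖` comes from `∫ g f ≈ 1` and `2` from `ℓ (π h) ≈ 1`, both in units of `η`.
  set η : ℝ := min (1 / 3) (ε / (6 + 4 * ‖f‖)) with hη
  have hη0 : 0 < η := by positivity
  have hη3 : η ≤ 1 / 3 := min_le_left _ _
  have hηε : η * (6 + 4 * ‖f‖) ≤ ε := by
    rw [← le_div_iff₀ (by positivity)]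
    exact min_le_right _ _
  set D : Set Ω := {x | 1 - η < ‖g₀ x‖} with hD
  have hDm : MeasurableSet D := measurableSet_lt measurable_const hg₀.norm
  -- Otherwise `‖g₀‖ ≤ 1 - η` almost everywhere, forcing `‖ℓ‖ < 1`.
  have hD0 : 0 < μ D := by
    rw [pos_iff_ne_zero]
    intro h0
    have hae : ∀ᵐ x ∂μ, ‖g₀ x‖ ≤ 1 - η := by
      filter_upwards [compl_mem_ae_iff.2 h0] with x hx
      exact not_lt.1 hx
    have : ‖ℓ‖ ≤ 1 - η := ℓ.opNorm_le_bound (by linarith) fun e' => by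
      obtain ⟨f', rfl, -⟩ := hlift e' 1 one_pos
      rw [hg₀i]
      exact hquot hg₀ (by linarith) hg₀b hae
        (fun z hz => by rw [← hg₀i, hZ0 z hz, map_zero]) f'
    linarith
  obtain ⟨x₀, hx₀, D₁, hD₁D, hD₁, hD₁0, hD₁g₀⟩ := exists_subset_dist_le hg₀ hDm hD0 hη0
  set c := g₀ x₀ with hc
  have hc1 : |‖c‖ - 1| ≤ η := by
    have h1 : 1 - η < ‖c‖ := hx₀
    rw [abs_le]
    constructor <;> linarith [hg₀b x₀]
  have hc1' : ‖(‖c‖ : 𝕜) - 1‖ ≤ η := by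
    rwa [← RCLike.ofReal_one, ← RCLike.ofReal_sub, RCLike.norm_ofReal]
  obtain ⟨g, hg, hgb, hgZ, hgf, B, hBD₁, hB, hB0, hgB⟩ :=
    exists_annihilator_near_const hμ hZ hsmall hg₁ hg₁b
      (fun z hz => by rw [← hg₁i, hZ0 z hz, map_zero]) f hD₁ hD₁0 (hg₀b x₀) hη0 hη3
  rw [hg₁f] at hgf
  obtain ⟨h, hh1, hh⟩ := exists_norm_le_one_norm_integral_sub_le hB hB0 c
  have hα : ‖∫ x, g x * h x ∂μ - 1‖ ≤ 6 * η := by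
    have h1 := hh g 1 (5 * η) hg hgb (by positivity) hgB
    refine (norm_sub_le_norm_sub_add_norm_sub _ (‖c‖ : 𝕜) _).trans ?_
    linarith
  have hβ : ‖ℓ (π h) - 1‖ ≤ 2 * η := by
    have h1 := hh g₀ 1 η hg₀ hg₀b hη0.le fun x hx => hD₁g₀ x (hBD₁ hx)
    rw [hg₀i]
    refine (norm_sub_le_norm_sub_add_norm_sub _ (‖c‖ : 𝕜) _).trans ?_
    linarith
  have hβ1 : ‖ℓ (π h)‖ ≤ 1 := by
    refine (ℓ.le_opNorm _).trans ?_
    rw [hℓ, one_mul]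
    exact (hπ h).trans hh1
  refine ⟨π h, (hπ h).trans hh1, fun a ha => ?_⟩
  set G := integralMulCLM μ hg hgb with hG
  set α := G h with hαG
  set β := ℓ (π h) with hβdef
  set γ := G f with hγG
  change ‖α - 1‖ ≤ 6 * η at hα
  change ‖γ - 1‖ ≤ η * (4 + 4 * ‖f‖) at hgf
  -- `g` induces a functional of norm at most `1` on the quotient; `α`, `β`, `γ` are all close to
  -- `1`.
  have h1 : ‖α + (a : 𝕜) * β * γ‖ ≤ ‖π h + ((a : 𝕜) * β) • π f‖ := by
    have h2 := hquot hg zero_le_one hgb (.of_forall hgb) hgZ (h + ((a : 𝕜) * β) • f)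
    rw [← integralMulCLM_apply hg hgb, map_add, map_smul, map_add, map_smul, one_mul,
      smul_eq_mul] at h2
    exact h2
  refine le_trans ?_ h1
  have h3 : ‖β * γ - 1‖ ≤ ε := by
    have h4 : β * γ - 1 = β * (γ - 1) + (β - 1) := by ring
    rw [h4]
    refine (norm_add_le _ _).trans ?_
    rw [norm_mul]
    have := mul_le_of_le_one_left (norm_nonneg (γ - 1)) hβ1
    linarith
  have h5 : ((1 + a : ℝ) : 𝕜) = α + (a : 𝕜) * β * γ - (α - 1) - (a : 𝕜) * (β * γ - 1) := by
    rw [RCLike.ofReal_add, RCLike.ofReal_one]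
    ring
  have h6 : 1 + a ≤ ‖α + (a : 𝕜) * β * γ‖ + ‖α - 1‖ + a * ‖β * γ - 1‖ := by
    calc 1 + a = ‖((1 + a : ℝ) : 𝕜)‖ := by rw [RCLike.norm_ofReal, abs_of_nonneg (by linarith)]
      _ ≤ ‖α + (a : 𝕜) * β * γ - (α - 1)‖ + ‖(a : 𝕜) * (β * γ - 1)‖ := by
          rw [h5]
          exact norm_sub_le _ _
      _ ≤ _ := by
          rw [norm_mul, RCLike.norm_ofReal, abs_of_nonneg ha]
          gcongr
          exact norm_sub_le _ _
  have h7 := mul_le_mul_of_nonneg_left h3 ha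
  have h8 : 6 * η ≤ ε := by nlinarith [norm_nonneg f]
  linarith

omit [IsProbabilityMeasure μ] in
theorem IsSmallSubspace.mono {X Z : Submodule 𝕜 (Lp 𝕜 1 μ)} (hX : IsSmallSubspace X)
    (hZX : Z ≤ X) : IsSmallSubspace Z := by
  rintro ⟨A, hA, hA0, h⟩
  refine hX ⟨A, hA, hA0, le_antisymm ?_ (h ▸ Submodule.map_mono hZX)⟩
  rintro _ ⟨z, -, rfl⟩
  exact projL1_mem_L1On hA z

end Quotient

theorem mainTheorem9 {𝕜 : Type*} [RCLike 𝕜] {Ω : Type*} [MeasurableSpace Ω]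
    (μ : Measure Ω) [IsProbabilityMeasure μ] (hμ : IsNonAtomicMeasure μ)
    (X : Submodule 𝕜 (Lp 𝕜 1 μ)) (hX : IsClosed (X : Set (Lp 𝕜 1 μ)))
    (hsmall : IsSmallSubspace X) :
    IsPoorSubspace X := by
  refine ⟨?_, hX, fun Z hZ hZX => ?_⟩
  -- Allowing an abstract `π` makes `L¹` itself the case of the identity map, with no need to
  -- identify it with its quotient by `⊥`.
  · exact hasDaugavetProperty_of_isSmallSubspace_ker hμ (Z := ⊥) isClosed_singleton
      (hsmall.mono bot_le) (ContinuousLinearMap.id 𝕜 _) (fun f => le_rfl)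
      (fun e δ hδ => ⟨e, rfl, by linarith⟩) (fun f => by simp)
  · exact hasDaugavetProperty_of_isSmallSubspace_ker hμ hZ (hsmall.mono hZX)
      Z.mkQL (fun f => Submodule.Quotient.norm_mk_le Z f)
      (fun e δ hδ => Submodule.Quotient.norm_mk_lt e hδ)
      (fun f => Submodule.Quotient.mk_eq_zero Z)
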